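/- All graphs are simple and possibly infinite. Let $G$ be a connected graph and $x_0$ a vertex of $G$. Two walks are homotopic if they have the same reduction, where reducing means iteratively replacing subwalks of the form $u\,e\,v\,e\,u$ by the trivial walk $u$; the fundamental group $\pi_1(G,x_0)$ is the group of homotopy classes of closed walks at $x_0$ under concatenation. For an integer $n\ge 0$, the $n$-local subgroup $\pi_1^n(G,x_0)\le \pi_1(G,x_0)$ is generated by the closed walks $W_0QW_0^-$ at $x_0$, where $Q$ is a closed walk once around a cycle of $G$ of length at most $n$. A covering $p\colon C\to G$ is a graph homomorphism, surjective on vertices and edges, that for every vertex $v$ of $C$ maps the edges at $v$ bijectively to the edges at $p(v)$. For every $n\ge 0$ let $p_n\colon G_n\to G$ be the $n$-local covering of $G$, that is, the (up to isomorphism unique) connected covering that induces an isomorphism from $\pi_1(G_n,\hat x)$ to $\pi_1^n(G,p_n(\hat x))$ for some vertex $\hat x$ of $G_n$. The displacement of $p_r$ is $$\Delta_r(G):=\min\{\operatorname{dist}_{G_r}(\hat u,\hat v) : \hat u\neq\hat v,\ p_r(\hat u)=p_r(\hat v)\}\in\mathbb N\cup\{\infty\},\qquad \min\emptyset:=\infty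 .$$ For an integer $\rho\ge 0$, the $(\rho/2)$-ball $B_G(v,\rho/2)$ consists of all vertices and edges traversed by closed walks in $G$ at $v$ of length at most $\rho$. A covering $p\colon C\to G$ preserves $(\rho/2)$-balls if it restricts to an isomorphism $B_C(v,\rho/2)\to B_G(p(v),\rho/2)$ for every vertex $v$ of $C$. Let $r\ge 0$ be an integer. Then for every integer $\rho\ge r$ the following assertions are equivalent: 1. $\Delta_r(G)>\rho$; 2. $p_r$ preserves $(\rho/2)$-balls; 3. $\pi_1^r(G,x_0)\supseteq\pi_1^\rho(G,x_0)$; 4. $p_r$ and $p_\rho$ are isomorphic as coverings of $G$. In particular, either $\Delta_r(G)=\infty$ and (1)-(4) hold for every integer $\rho\ge r$, or $\Delta_r(G)$ is finite and $\Delta_r(G)-1$ is the maximum integer $\rho\ge r$ that satisfies (1)-(4). -/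

import Mathlib

universe u

namespace LocalCovering

open SimpleGraph

section FundamentalGroup

variable {V : Type*} {G : SimpleGraph V}

/-- One reduction step on walks: a subwalk `w e x e w` is replaced by the trivial walk `w`. -/
inductive ReductionStep {u v : V} : G.Walk u v → G.Walk u v → Prop
  | spur {w x : V} (p : G.Walk u w) (h : G.Adj w x) (q : G.Walk w v) :
      ReductionStep (p.append (Walk.cons h (Walk.cons h.symm q))) (p.append q)

variable (G) in
/-- Homotopy classes of walks from `u` to `v`: the quotient of the walks by the equivalence relation
generated by `ReductionStep`. -/
def HomotopyClass (u v : V) : Type _ := Quot (@ReductionStep V G u v)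

namespace HomotopyClass

/-- The class of a walk. -/
def mk {u v : V} (p : G.Walk u v) : HomotopyClass G u v := Quot.mk _ p

theorem append_left {u v w : V} (a : G.Walk u v) {p q : G.Walk v w} (h : ReductionStep p q) :
    ReductionStep (a.append p) (a.append q) := by
  cases h with
  | spur b h c =>
    rw [Walk.append_assoc, Walk.append_assoc]
    exact .spur _ h _

theorem append_right {u v w : V} {p q : G.Walk u v} (h : ReductionStep p q) (a : G.Walk v w) :
    ReductionStep (p.append a) (q.append a) := by
  cases h with
  | spur b h c =>
    rw [← Walk.append_assoc, ← Walk.append_assoc]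
    exact .spur _ h _

theorem reverse_step {u v : V} {p q : G.Walk u v} (h : ReductionStep p q) :
    ReductionStep p.reverse q.reverse := by
  cases h with
  | spur b h c =>
    have := ReductionStep.spur c.reverse h b.reverse
    simpa [← Walk.append_assoc] using this

/-- Concatenation of homotopy classes of walks. -/
def comp {u v w : V} : HomotopyClass G u v → HomotopyClass G v w → HomotopyClass G u w :=
  Quot.map₂ Walk.append (fun a _ _ h => append_left a h) (fun _ _ b h => append_right h b)

/-- Reversal of homotopy classes of walks. -/
def inv {u v : V} : HomotopyClass G u v → HomotopyClass G v u :=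
  Quot.map Walk.reverse (fun _ _ h => reverse_step h)

theorem comp_mk {u v w : V} (p : G.Walk u v) (q : G.Walk v w) :
    comp (mk p) (mk q) = mk (p.append q) := rfl

theorem inv_mk {u v : V} (p : G.Walk u v) : inv (mk p) = mk p.reverse := rfl

theorem comp_assoc {u v w x : V} (a : HomotopyClass G u v) (b : HomotopyClass G v w)
    (c : HomotopyClass G w x) : comp (comp a b) c = comp a (comp b c) := by
  induction a using Quot.ind
  induction b using Quot.ind
  induction c using Quot.ind
  exact congrArg mk (Walk.append_assoc _ _ _).symm

theorem nil_comp {u v : V} (a : HomotopyClass G u v) : comp (mk Walk.nil) a = a := by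
  induction a using Quot.ind
  rfl

theorem comp_nil {u v : V} (a : HomotopyClass G u v) : comp a (mk Walk.nil) = a := by
  induction a using Quot.ind
  exact congrArg mk (Walk.append_nil _)

theorem inv_comp {u v : V} (a : HomotopyClass G u v) : comp (inv a) a = mk Walk.nil := by
  induction a using Quot.ind with
  | mk p =>
    change mk (p.reverse.append p) = _
    induction p with
    | nil => rfl
    | cons h p ih =>
      rw [← ih]
      have := ReductionStep.spur p.reverse h.symm p
      refine Quot.sound ?_
      simpa [← Walk.append_assoc] using this

theorem inv_inv {u v : V} (a : HomotopyClass G u v) : inv (inv a) = a := by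
  induction a using Quot.ind
  exact congrArg mk (Walk.reverse_reverse _)

theorem comp_inv {u v : V} (a : HomotopyClass G u v) : comp a (inv a) = mk Walk.nil := by
  simpa [inv_inv] using inv_comp (inv a)

end HomotopyClass

variable (G) in
/-- The (combinatorial) fundamental group of `G` at `x`: homotopy classes of closed walks at `x`,
multiplied by concatenation. -/
abbrev FundGroup (x : V) : Type _ := HomotopyClass G x x

instance (x : V) : Group (FundGroup G x) where
  mul := HomotopyClass.comp
  one := HomotopyClass.mk Walk.nil
  inv := HomotopyClass.inv
  mul_assoc := HomotopyClass.comp_assoc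
  one_mul := HomotopyClass.nil_comp
  mul_one := HomotopyClass.comp_nil
  inv_mul_cancel := HomotopyClass.inv_comp

variable (G) in
/-- The `r`-local subgroup of the fundamental group of `G` at `x`: it is generated by the closed
walks `P Q P⁻` where `P` is a walk starting at `x` and `Q` is a closed walk once around a cycle of
length at most `r`. -/
def localSubgroup (r : ℕ) (x : V) : Subgroup (FundGroup G x) :=
  Subgroup.closure {g | ∃ (y : V) (P : G.Walk x y) (Q : G.Walk y y),
    Q.IsCycle ∧ Q.length ≤ r ∧ g = HomotopyClass.mk ((P.append Q).append P.reverse)}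

end FundamentalGroup

section Coverings

variable {V W W' : Type*} {G : SimpleGraph V} {C : SimpleGraph W} {D : SimpleGraph W'}

theorem map_step (p : C →g G) {u v : W} {P Q : C.Walk u v} (h : ReductionStep P Q) :
    ReductionStep (P.map p) (Q.map p) := by
  cases h with
  | spur a h b =>
    simpa [Walk.map_append] using ReductionStep.spur (a.map p) (p.map_adj h) (b.map p)

/-- The homomorphism of fundamental groups induced by a graph homomorphism. -/
def inducedMap (p : C →g G) (x : W) : FundGroup C x →* FundGroup G (p x) where
  toFun := Quot.map (fun P => P.map p) (fun _ _ h => map_step p h)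
  map_one' := rfl
  map_mul' a b := by
    induction a using Quot.ind
    induction b using Quot.ind
    exact congrArg HomotopyClass.mk (Walk.map_append _ _ _)

/-- A covering of `G`: a homomorphism `p : C → G`, surjective on vertices and on edges, that for
every vertex `v` of `C` maps the edges at `v` bijectively to the edges at `p v`. -/
structure IsCovering (p : C →g G) : Prop where
  surjective_vertices : Function.Surjective p
  surjective_edges : Set.SurjOn (Sym2.map p) C.edgeSet G.edgeSet
  bijOn_incidence : ∀ v : W, Set.BijOn (Sym2.map p) (C.incidenceSet v) (G.incidenceSet (p v))

/-- An `r`-local covering of `G`: a connected covering that induces, for some base vertex, an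
isomorphism from the fundamental group of `C` to the `r`-local subgroup. -/
structure IsLocalCovering (r : ℕ) (p : C →g G) : Prop where
  connected : C.Connected
  isCovering : IsCovering p
  induces_iso : ∃ x : W, Function.Injective (inducedMap p x) ∧
    (inducedMap p x).range = localSubgroup G r (p x)

/-- Isomorphism of coverings of `G`. -/
def CoveringIso (p : C →g G) (q : D →g G) : Prop :=
  ∃ φ : C ≃g D, ∀ x, q (φ x) = p x

/-- The displacement of `p`: the least distance between two distinct lifts of a common vertex;
it is `⊤` if there are no such lifts. -/
noncomputable def displacement (p : C →g G) : ℕ∞ :=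
  sInf {d | ∃ u v : W, u ≠ v ∧ p u = p v ∧ d = C.edist u v}

variable (G) in
/-- The combinatorial `(ρ/2)`-ball around `v`: all vertices and edges traversed by closed walks
at `v` of length at most `ρ`. -/
def halfBall (v : V) (ρ : ℕ) : G.Subgraph where
  verts := {x | ∃ P : G.Walk v v, P.length ≤ ρ ∧ x ∈ P.support}
  Adj a b := ∃ P : G.Walk v v, P.length ≤ ρ ∧ s(a, b) ∈ P.edges
  adj_sub := fun ⟨P, _, h⟩ => P.adj_of_mem_edges h
  edge_vert := fun ⟨P, hP, h⟩ => ⟨P, hP, P.fst_mem_support_of_mem_edges h⟩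
  symm := ⟨fun _ _ ⟨P, hP, h⟩ => ⟨P, hP, Sym2.eq_swap ▸ h⟩⟩

/-- `p` preserves `(ρ/2)`-balls: for every vertex `v` of `C` it restricts to an isomorphism from
the `(ρ/2)`-ball around `v` to the `(ρ/2)`-ball around `p v`. -/
def PreservesHalfBalls (p : C →g G) (ρ : ℕ) : Prop :=
  ∀ v : W, ∃ φ : (halfBall C v ρ).coe ≃g (halfBall G (p v) ρ).coe, ∀ x, (φ x : V) = p x

end Coverings

section Existence

variable {V : Type*} {G : SimpleGraph V} {x₀ : V} (H : Subgroup (FundGroup G x₀))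

/-- Homotopy classes of walks from `x₀` to `v`, up to left multiplication by `H`. -/
def fibreSetoid (v : V) : Setoid (HomotopyClass G x₀ v) where
  r a b := (HomotopyClass.comp a (HomotopyClass.inv b) : FundGroup G x₀) ∈ H
  iseqv := by
    refine ⟨fun a => ?_, fun {a b} h => ?_, fun {a b c} h k => ?_⟩
    · rw [HomotopyClass.comp_inv]; exact H.one_mem
    · have := H.inv_mem h
      convert this using 1
      symm
      rw [inv_eq_iff_mul_eq_one]
      change HomotopyClass.comp (HomotopyClass.comp a _) (HomotopyClass.comp b _) = _
      rw [HomotopyClass.comp_assoc, ← HomotopyClass.comp_assoc (HomotopyClass.inv b),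
        HomotopyClass.inv_comp, HomotopyClass.nil_comp, HomotopyClass.comp_inv]
      rfl
    · have := H.mul_mem h k
      convert this using 1
      change _ = HomotopyClass.comp (HomotopyClass.comp a _) (HomotopyClass.comp b _)
      rw [HomotopyClass.comp_assoc, ← HomotopyClass.comp_assoc (HomotopyClass.inv b),
        HomotopyClass.inv_comp, HomotopyClass.nil_comp]

/-- The fibre over `v` of the covering with characteristic subgroup `H`. -/
def Fibre (v : V) : Type _ := Quotient (fibreSetoid H v)

variable {H}

theorem inv_comp_rev {u v w : V} (a : HomotopyClass G u v) (b : HomotopyClass G v w) :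
    HomotopyClass.inv (HomotopyClass.comp a b) =
      HomotopyClass.comp (HomotopyClass.inv b) (HomotopyClass.inv a) := by
  induction a using Quot.ind
  induction b using Quot.ind
  exact congrArg HomotopyClass.mk (Walk.reverse_append _ _)

/-- Moving along an edge in the covering. -/
def Fibre.move {v w : V} (h : G.Adj v w) : Fibre H v → Fibre H w :=
  Quotient.map' (fun a => HomotopyClass.comp a (HomotopyClass.mk h.toWalk)) (by
    intro a b hab
    change HomotopyClass.comp (HomotopyClass.comp a _) (HomotopyClass.inv (HomotopyClass.comp b _)) ∈ H
    rw [inv_comp_rev, HomotopyClass.comp_assoc, ← HomotopyClass.comp_assoc (HomotopyClass.mk _),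
      HomotopyClass.comp_inv, HomotopyClass.nil_comp]
    exact hab)

theorem Fibre.move_move {v w : V} (h : G.Adj v w) (a : Fibre H v) :
    Fibre.move h.symm (Fibre.move h a) = a := by
  induction a using Quotient.ind with
  | _ a =>
    refine congrArg (Quotient.mk _) ?_
    dsimp only
    rw [HomotopyClass.comp_assoc]
    have : HomotopyClass.comp (HomotopyClass.mk h.toWalk) (HomotopyClass.mk h.symm.toWalk)
        = HomotopyClass.mk Walk.nil := HomotopyClass.comp_inv (HomotopyClass.mk h.toWalk)
    rw [this, HomotopyClass.comp_nil]

variable (H) in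
/-- The covering graph of `G` with characteristic subgroup `H`. -/
def coverGraph : SimpleGraph (Σ v, Fibre H v) where
  Adj x y := ∃ h : G.Adj x.1 y.1, y.2 = Fibre.move h x.2
  symm := ⟨fun _ _ ⟨h, e⟩ => ⟨h.symm, by rw [e, Fibre.move_move]⟩⟩
  loopless := ⟨fun _ ⟨h, _⟩ => h.ne rfl⟩

variable (H) in
/-- The covering map. -/
def coverMap : coverGraph H →g G where
  toFun := Sigma.fst
  map_rel' := fun ⟨h, _⟩ => h

theorem coverAdj {v w : V} (h : G.Adj v w) (a : Fibre H v) :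
    (coverGraph H).Adj ⟨v, a⟩ ⟨w, Fibre.move h a⟩ := ⟨h, rfl⟩

/-- The lift of a walk from a given lift of its first vertex, up to homotopy. -/
def liftClass : {v w : V} → G.Walk v w → (a : Fibre H v) →
    Σ b : Fibre H w, HomotopyClass (coverGraph H) ⟨v, a⟩ ⟨w, b⟩
  | _, _, .nil, a => ⟨a, HomotopyClass.mk Walk.nil⟩
  | _, _, .cons h p, a =>
    ⟨(liftClass p (Fibre.move h a)).1,
      HomotopyClass.comp (HomotopyClass.mk (coverAdj h a).toWalk)
        (liftClass p (Fibre.move h a)).2⟩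

theorem liftClass_spur {v w x : V} (h : G.Adj v w) (q : G.Walk v x) (a : Fibre H v) :
    liftClass (Walk.cons h (Walk.cons h.symm q)) a = liftClass q a := by
  have key : ∀ (a' : Fibre H v) (_ : a' = a) (e : (coverGraph H).Adj ⟨w, Fibre.move h a⟩ ⟨v, a'⟩),
      (⟨(liftClass q a').1, HomotopyClass.comp (HomotopyClass.mk (coverAdj h a).toWalk)
        (HomotopyClass.comp (HomotopyClass.mk e.toWalk) (liftClass q a').2)⟩ :
        Σ b : Fibre H x, HomotopyClass (coverGraph H) ⟨v, a⟩ ⟨x, b⟩) = liftClass q a := by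
    rintro a' rfl e
    rw [← HomotopyClass.comp_assoc]
    have : HomotopyClass.comp (HomotopyClass.mk (coverAdj h a').toWalk) (HomotopyClass.mk e.toWalk)
        = HomotopyClass.mk Walk.nil := HomotopyClass.comp_inv (HomotopyClass.mk (coverAdj h a').toWalk)
    rw [this, HomotopyClass.nil_comp]
  exact key _ (Fibre.move_move h a) _

theorem liftClass_step {v w : V} {p q : G.Walk v w} (h : ReductionStep p q) (a : Fibre H v) :
    liftClass p a = liftClass q a := by
  cases h with
  | spur b h c =>
    induction b with
    | nil => exact liftClass_spur h c a
    | cons k b ih =>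
      simp only [Walk.cons_append, liftClass]
      rw [ih]

theorem liftClass_map {x y : Σ v, Fibre H v} (Q : (coverGraph H).Walk x y) :
    liftClass (Q.map (coverMap H)) x.2 = ⟨y.2, HomotopyClass.mk Q⟩ := by
  induction Q with
  | nil => rfl
  | @cons x z y h Q ih =>
    obtain ⟨x, a⟩ := x
    obtain ⟨z, c⟩ := z
    obtain ⟨h', e⟩ := h
    dsimp only at h' e
    subst e
    change (⟨(liftClass (Q.map (coverMap H)) (Fibre.move h' a)).1,
      HomotopyClass.comp (HomotopyClass.mk (coverAdj h' a).toWalk)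
        (liftClass (Q.map (coverMap H)) (Fibre.move h' a)).2⟩ :
        Σ b : Fibre H y.1, HomotopyClass (coverGraph H) ⟨x, a⟩ ⟨y.1, b⟩) = _
    exact congrArg (fun t : (Σ b : Fibre H y.1,
        HomotopyClass (coverGraph H) ⟨z, Fibre.move h' a⟩ ⟨y.1, b⟩) =>
      (⟨t.1, HomotopyClass.comp (HomotopyClass.mk (coverAdj h' a).toWalk) t.2⟩ :
        Σ b : Fibre H y.1, HomotopyClass (coverGraph H) ⟨x, a⟩ ⟨y.1, b⟩)) ih

theorem exists_lift {v w : V} (P : G.Walk v w) (a : Fibre H v) :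
    ∃ (b : Fibre H w) (Q : (coverGraph H).Walk ⟨v, a⟩ ⟨w, b⟩), Q.map (coverMap H) = P := by
  induction P with
  | nil => exact ⟨a, Walk.nil, rfl⟩
  | cons h P ih =>
    obtain ⟨b, Q, hQ⟩ := ih (Fibre.move h a)
    exact ⟨b, Walk.cons (coverAdj h a) Q, by rw [← hQ]; rfl⟩

theorem walk_fibre {x y : Σ v, Fibre H v} (Q : (coverGraph H).Walk x y) (c : HomotopyClass G x₀ x.1)
    (hc : x.2 = Quotient.mk _ c) :
    y.2 = Quotient.mk _ (HomotopyClass.comp c (HomotopyClass.mk (Q.map (coverMap H)))) := by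
  induction Q with
  | nil => rw [hc]; exact congrArg _ (HomotopyClass.comp_nil c).symm
  | @cons x z y h Q ih =>
    obtain ⟨h', e⟩ := h
    have := ih (HomotopyClass.comp c (HomotopyClass.mk h'.toWalk)) (by rw [e, hc]; rfl)
    rw [this, HomotopyClass.comp_assoc]
    rfl

variable (H) in
/-- The base vertex of the covering. -/
def coverBase : Σ v, Fibre H v := ⟨x₀, Quotient.mk _ (HomotopyClass.mk Walk.nil)⟩

theorem coverGraph_connected : (coverGraph H).Connected := by
  have key : ∀ y, (coverGraph H).Reachable (coverBase H) y := by
    rintro ⟨v, a⟩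
    induction a using Quotient.ind with
    | _ a =>
      induction a using Quot.ind with
      | mk P =>
        obtain ⟨b, Q, hQ⟩ := exists_lift P (coverBase H).2
        have := walk_fibre Q (HomotopyClass.mk Walk.nil) rfl
        rw [hQ, HomotopyClass.nil_comp] at this
        have e : (⟨v, b⟩ : Σ v, Fibre H v) = ⟨v, Quotient.mk _ (Quot.mk _ P)⟩ :=
          congrArg (Sigma.mk v) this
        exact e ▸ ⟨Q⟩
  have : Nonempty (Σ v, Fibre H v) := ⟨coverBase H⟩
  exact ⟨fun x y => (key x).symm.trans (key y)⟩

theorem coverMap_isCovering (hG : G.Connected) : IsCovering (coverMap H) := by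
  have hs : Function.Surjective (coverMap H) := by
    intro v
    obtain ⟨P⟩ := hG x₀ v
    exact ⟨⟨v, Quotient.mk _ (HomotopyClass.mk P)⟩, rfl⟩
  refine ⟨hs, ?_, ?_⟩
  · intro e he
    induction e using Sym2.ind with
    | _ v w =>
      obtain ⟨⟨v, a⟩, rfl⟩ := hs v
      exact ⟨s(⟨v, a⟩, ⟨w, Fibre.move he a⟩), coverAdj (H := H) he a, rfl⟩
  · rintro ⟨v, a⟩
    refine ⟨?_, ?_, ?_⟩
    · rintro e ⟨he, hv⟩
      refine ⟨(coverMap H).map_mem_edgeSet he, ?_⟩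
      exact Sym2.mem_map.2 ⟨_, hv, rfl⟩
    · rintro e ⟨he, hv⟩ e' ⟨he', hv'⟩ h
      obtain ⟨⟨w, b⟩, rfl⟩ := hv
      obtain ⟨⟨w', b'⟩, rfl⟩ := hv'
      obtain ⟨k, e⟩ := he
      obtain ⟨k', e'⟩ := he'
      dsimp only at k k' e e'
      subst e e'
      have : w = w' := by
        simp only [Sym2.map_mk] at h
        exact Sym2.congr_right.1 h
      subst this
      rfl
    · rintro e ⟨he, hv⟩
      obtain ⟨w, rfl⟩ := hv
      exact ⟨s(⟨v, a⟩, ⟨w, Fibre.move he a⟩), ⟨coverAdj (H := H) he a, Sym2.mem_mk_left _ _⟩, rfl⟩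

/-- Every connected graph has an `r`-local covering. -/
theorem exists_isLocalCovering {V : Type u} {G : SimpleGraph V} (hG : G.Connected) (r : ℕ) :
    ∃ (W : Type u) (C : SimpleGraph W) (p : C →g G), IsLocalCovering r p := by
  obtain ⟨x₀⟩ := hG.nonempty
  let H := localSubgroup G r x₀
  refine ⟨_, coverGraph H, coverMap H, coverGraph_connected, coverMap_isCovering hG,
    coverBase H, ?_, ?_⟩
  · intro a b h
    induction a using Quot.ind with
    | mk P =>
    induction b using Quot.ind with
    | mk Q =>
      have h1 : ∀ P Q : G.Walk x₀ x₀, HomotopyClass.mk P = HomotopyClass.mk Q →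
          liftClass P (coverBase H).2 = liftClass Q (coverBase H).2 := fun P Q h =>
        congrArg (Quot.lift (fun P : G.Walk x₀ x₀ => liftClass P (coverBase H).2)
          (fun _ _ h => liftClass_step h _)) h
      have h2 := h1 _ _ h
      erw [liftClass_map P, liftClass_map Q] at h2
      exact eq_of_heq (Sigma.mk.inj h2).2
  · have mem_iff : ∀ g : FundGroup G x₀,
        (Quotient.mk (fibreSetoid H x₀) (HomotopyClass.mk Walk.nil) = Quotient.mk _ g) ↔ g ∈ H := by
      intro g
      rw [Quotient.eq]
      change HomotopyClass.comp (HomotopyClass.mk Walk.nil) (HomotopyClass.inv g) ∈ H ↔ _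
      rw [HomotopyClass.nil_comp]
      exact H.inv_mem_iff
    ext g
    constructor
    · rintro ⟨a, rfl⟩
      induction a using Quot.ind with
      | mk P =>
        have := walk_fibre P (HomotopyClass.mk Walk.nil) rfl
        exact (mem_iff _).1 this
    · intro hg
      induction g using Quot.ind with
      | mk P =>
        change G.Walk x₀ x₀ at P
        obtain ⟨b, Q, hQ⟩ := exists_lift P (coverBase H).2
        have h1 : b = Quotient.mk (fibreSetoid H x₀)
            (HomotopyClass.mk (Q.map (coverMap H))) :=
          walk_fibre Q (HomotopyClass.mk Walk.nil) rfl
        have h2 : b = (coverBase H).2 :=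
          (h1.trans (congrArg (fun R : G.Walk x₀ x₀ => Quotient.mk (fibreSetoid H x₀)
            (HomotopyClass.mk R)) hQ)).trans ((mem_iff _).2 hg).symm
        subst h2
        exact ⟨HomotopyClass.mk Q, congrArg HomotopyClass.mk hQ⟩

end Existence

end LocalCovering

/-!
A covering has unique lifting of walks, and the end of a lift depends only on the homotopy class of
the walk. So homotopy classes of walks act on lifts of vertices (`monodromy`), and the subgroup of
the fundamental group induced by a covering is the stabilizer of the base vertex. Conjugation along
walks carries local subgroups to local subgroups, so for an `r`-local covering the stabilizer of
*every* lift of a vertex `a` is the `r`-local subgroup at `a`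
(`IsLocalCovering.mem_localSubgroup_iff`).

With this, `Δ > ρ` says that a closed walk of length at most `ρ` lifts only to closed walks, while
`π₁^ρ ≤ π₁^r` says the same of cycles of length at most `ρ`. The two agree because every closed
walk of length at most `ρ` is homotopic to a product of conjugates of cycles of length at most `ρ`
(`mk_mem_localSubgroup`). Taking `ρ = r` gives `Δ > r`, which makes `Δ - 1` an admissible value of
`ρ` when `Δ` is finite. Connected coverings with equal stabilizers are isomorphic, by the lifting
criterion `exists_coveringHom`.

The equivalence of `Δ > ρ` with the preservation of `(ρ/2)`-balls holds for any covering. If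
`Δ > ρ`, closed walks of length at most `ρ` lift to closed walks, and two vertices of a ball are at
distance at most `ρ`. For the converse, a short walk joining two lifts of one vertex is seen in the
ball around its middle vertex (`PreservesHalfBalls.lt_displacement`).
-/

namespace LocalCovering

open SimpleGraph

universe v w w'

variable {V : Type v} {W : Type w} {W' : Type w'} {G : SimpleGraph V} {C : SimpleGraph W}
  {D : SimpleGraph W'} {p : C →g G} {q : D →g G}

/-! ### Unique lifting and monodromy -/

theorem IsCovering.exists_adj_lift (hp : IsCovering p) {x : W} {b : V} (h : G.Adj (p x) b) :
    ∃ y, C.Adj x y ∧ p y = b := by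
  obtain ⟨e, ⟨he, hx⟩, hb⟩ :=
    (hp.bijOn_incidence x).surjOn (show s(p x, b) ∈ G.incidenceSet (p x) from
      ⟨h, Sym2.mem_mk_left _ _⟩)
  obtain ⟨y, rfl⟩ := hx
  exact ⟨y, he, Sym2.congr_right.1 hb⟩

theorem IsCovering.adj_lift_unique (hp : IsCovering p) {x y z : W} (hy : C.Adj x y)
    (hz : C.Adj x z) (h : p y = p z) : y = z := by
  refine Sym2.congr_right.1 ((hp.bijOn_incidence x).injOn (x₁ := s(x, y)) (x₂ := s(x, z))
    ⟨hy, Sym2.mem_mk_left _ _⟩ ⟨hz, Sym2.mem_mk_left _ _⟩ ?_)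
  simp [h]

variable (p) in
/-- The lifts of a vertex `a` of `G` to the domain of `p`. -/
abbrev VertexLift (a : V) : Type w := {x : W // p x = a}

/-- The other end of the unique lift of an edge `ab` at a given lift of `a`. -/
noncomputable def moveLift (hp : IsCovering p) {a b : V} (h : G.Adj a b) (x : VertexLift p a) :
    VertexLift p b :=
  ⟨_, (hp.exists_adj_lift (x := x.1) (b := b) (x.2.symm ▸ h)).choose_spec.2⟩

theorem adj_moveLift (hp : IsCovering p) {a b : V} (h : G.Adj a b) (x : VertexLift p a) :
    C.Adj x.1 (moveLift hp h x).1 :=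
  (hp.exists_adj_lift (x := x.1) (b := b) (x.2.symm ▸ h)).choose_spec.1

theorem moveLift_eq (hp : IsCovering p) {a b : V} (h : G.Adj a b) {x : VertexLift p a}
    {y : VertexLift p b} (hxy : C.Adj x.1 y.1) : moveLift hp h x = y :=
  Subtype.ext (hp.adj_lift_unique (adj_moveLift hp h x) hxy ((moveLift hp h x).2.trans y.2.symm))

/-- The end of the unique lift of a walk from `a` to `b` at a given lift of `a`. -/
noncomputable def walkLift (hp : IsCovering p) :
    {a b : V} → G.Walk a b → VertexLift p a → VertexLift p b
  | _, _, .nil, x => x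
  | _, _, .cons h P, x => walkLift hp P (moveLift hp h x)

theorem walkLift_append (hp : IsCovering p) {a b c : V} (P : G.Walk a b) (Q : G.Walk b c)
    (x : VertexLift p a) : walkLift hp (P.append Q) x = walkLift hp Q (walkLift hp P x) := by
  induction P with
  | nil => rfl
  | cons h P ih => exact ih Q _

theorem walkLift_step (hp : IsCovering p) {a b : V} {P Q : G.Walk a b} (h : ReductionStep P Q)
    (x : VertexLift p a) : walkLift hp P x = walkLift hp Q x := by
  cases h with
  | spur A h B =>
    simp only [walkLift_append, walkLift]
    rw [moveLift_eq hp h.symm (adj_moveLift hp h _).symm]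

/-- The action of a homotopy class of walks from `a` to `b` on the lifts of `a`. -/
noncomputable def monodromy (hp : IsCovering p) {a b : V} (c : HomotopyClass G a b)
    (x : VertexLift p a) : VertexLift p b :=
  Quot.lift (fun P => walkLift hp P x) (fun _ _ h => walkLift_step hp h x) c

theorem monodromy_comp (hp : IsCovering p) {a b c : V} (g : HomotopyClass G a b)
    (h : HomotopyClass G b c) (x : VertexLift p a) :
    monodromy hp (HomotopyClass.comp g h) x = monodromy hp h (monodromy hp g x) := by
  induction g using Quot.ind
  induction h using Quot.ind
  exact walkLift_append hp _ _ x

theorem monodromy_inv_eq_iff (hp : IsCovering p) {a b : V} (g : HomotopyClass G a b)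
    (x : VertexLift p a) (y : VertexLift p b) :
    monodromy hp (HomotopyClass.inv g) y = x ↔ monodromy hp g x = y := by
  constructor
  · rintro rfl
    rw [← monodromy_comp, HomotopyClass.inv_comp]
    rfl
  · rintro rfl
    rw [← monodromy_comp, HomotopyClass.comp_inv]
    rfl

theorem monodromy_comp_inv_eq_iff (hp : IsCovering p) {a b : V} (g h : HomotopyClass G a b)
    (x : VertexLift p a) :
    monodromy hp (HomotopyClass.comp g (HomotopyClass.inv h)) x = x ↔
      monodromy hp g x = monodromy hp h x := by
  rw [monodromy_comp, monodromy_inv_eq_iff, eq_comm]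

theorem walkLift_map (hp : IsCovering p) {x y : W} (Q : C.Walk x y) :
    walkLift hp (Q.map p) (⟨x, rfl⟩ : VertexLift p (p x)) = ⟨y, rfl⟩ := by
  induction Q with
  | nil => rfl
  | @cons x z y h Q ih =>
    change walkLift hp (Q.map p) (moveLift hp (p.map_adj h) ⟨x, rfl⟩) = _
    rw [moveLift_eq hp (p.map_adj h) (y := ⟨z, rfl⟩) h, ih]

theorem exists_walk_to_walkLift (hp : IsCovering p) {a b : V} (P : G.Walk a b)
    (x : VertexLift p a) :
    ∃ Q : C.Walk x.1 (walkLift hp P x).1, (Q.map p).copy x.2 (walkLift hp P x).2 = P := by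
  induction P with
  | nil =>
    obtain ⟨x, rfl⟩ := x
    exact ⟨Walk.nil, rfl⟩
  | @cons a c b h P ih =>
    obtain ⟨Q, hQ⟩ := ih (moveLift hp h x)
    refine ⟨Walk.cons (adj_moveLift hp h x) Q, ?_⟩
    have hadj := adj_moveLift hp h x
    change (Walk.cons (p.map_adj hadj) (Q.map p)).copy _ (walkLift hp P (moveLift hp h x)).2 = _
    generalize moveLift hp h x = y at Q hQ hadj
    obtain ⟨x, rfl⟩ := x
    obtain ⟨y, rfl⟩ := y
    rw [Walk.copy_cons]
    exact congrArg (Walk.cons h) hQ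

theorem edist_walkLift_le (hp : IsCovering p) {a b : V} (P : G.Walk a b) (x : VertexLift p a) :
    C.edist x.1 (walkLift hp P x).1 ≤ P.length := by
  obtain ⟨Q, hQ⟩ := exists_walk_to_walkLift hp P x
  have hl := congrArg Walk.length hQ
  rw [Walk.length_copy, Walk.length_map] at hl
  exact hl ▸ Walk.edist_le Q

theorem exists_monodromy_eq (hp : IsCovering p) (hC : C.Connected) {a b : V} (x : VertexLift p a)
    (y : VertexLift p b) : ∃ c : HomotopyClass G a b, monodromy hp c x = y := by
  obtain ⟨x, rfl⟩ := x
  obtain ⟨y, rfl⟩ := y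
  obtain ⟨Q⟩ := hC x y
  exact ⟨HomotopyClass.mk (Q.map p), walkLift_map hp Q⟩

/-- The image of the fundamental group of the covering graph is the stabilizer of the base vertex
under monodromy. -/
theorem mem_range_inducedMap_iff (hp : IsCovering p) (x : W) (g : FundGroup G (p x)) :
    g ∈ (inducedMap p x).range ↔ monodromy hp g ⟨x, rfl⟩ = ⟨x, rfl⟩ := by
  constructor
  · rintro ⟨Q, rfl⟩
    induction Q using Quot.ind with
    | mk Q => exact walkLift_map hp Q
  · induction g using Quot.ind with
    | mk P =>
      intro h
      change walkLift hp P ⟨x, rfl⟩ = _ at h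
      obtain ⟨Q, hQ⟩ := exists_walk_to_walkLift hp P ⟨x, rfl⟩
      generalize walkLift hp P ⟨x, rfl⟩ = y at h Q hQ
      subst h
      exact ⟨HomotopyClass.mk Q, congrArg HomotopyClass.mk hQ⟩

/-! ### Short closed walks and local subgroups -/

theorem localSubgroup_mono {r ρ : ℕ} (h : r ≤ ρ) (a : V) :
    localSubgroup G r a ≤ localSubgroup G ρ a := by
  refine Subgroup.closure_mono ?_
  rintro g ⟨y, P, Q, hQ, hl, rfl⟩
  exact ⟨y, P, Q, hQ, hl.trans h, rfl⟩

/-- Change of base vertex along a homotopy class of walks, as a homomorphism. -/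
def conjHom {a b : V} (c : HomotopyClass G a b) : FundGroup G b →* FundGroup G a where
  toFun g := HomotopyClass.comp c (HomotopyClass.comp g (HomotopyClass.inv c))
  map_one' := by
    change HomotopyClass.comp c (HomotopyClass.comp (HomotopyClass.mk Walk.nil) _) = _
    rw [HomotopyClass.nil_comp, HomotopyClass.comp_inv]
    rfl
  map_mul' g h := by
    change HomotopyClass.comp c (HomotopyClass.comp (HomotopyClass.comp g h) _) =
      HomotopyClass.comp (HomotopyClass.comp c (HomotopyClass.comp g (HomotopyClass.inv c)))
        (HomotopyClass.comp c (HomotopyClass.comp h (HomotopyClass.inv c)))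
    simp only [HomotopyClass.comp_assoc]
    rw [← HomotopyClass.comp_assoc (HomotopyClass.inv c) c, HomotopyClass.inv_comp,
      HomotopyClass.nil_comp]

theorem conjHom_inv_conjHom {a b : V} (c : HomotopyClass G a b) (g : FundGroup G b) :
    conjHom (HomotopyClass.inv c) (conjHom c g) = g := by
  change HomotopyClass.comp (HomotopyClass.inv c) (HomotopyClass.comp (HomotopyClass.comp c
    (HomotopyClass.comp g (HomotopyClass.inv c))) (HomotopyClass.inv (HomotopyClass.inv c))) = g
  rw [HomotopyClass.inv_inv]
  simp only [HomotopyClass.comp_assoc]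
  rw [HomotopyClass.inv_comp, HomotopyClass.comp_nil, ← HomotopyClass.comp_assoc,
    HomotopyClass.inv_comp, HomotopyClass.nil_comp]

theorem conjHom_mem_localSubgroup {r : ℕ} {a b : V} (c : HomotopyClass G a b)
    {g : FundGroup G b} (hg : g ∈ localSubgroup G r b) : conjHom c g ∈ localSubgroup G r a := by
  suffices localSubgroup G r b ≤ (localSubgroup G r a).comap (conjHom c) from this hg
  refine (Subgroup.closure_le _).2 ?_
  rintro _ ⟨y, P, Q, hQ, hl, rfl⟩
  induction c using Quot.ind with
  | mk R =>
    refine Subgroup.subset_closure ⟨y, R.append P, Q, hQ, hl, ?_⟩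
    change HomotopyClass.mk (R.append (((P.append Q).append P.reverse).append R.reverse)) = _
    simp only [Walk.append_assoc, Walk.reverse_append]

theorem conjHom_mem_localSubgroup_iff {r : ℕ} {a b : V} (c : HomotopyClass G a b)
    (g : FundGroup G b) : conjHom c g ∈ localSubgroup G r a ↔ g ∈ localSubgroup G r b := by
  refine ⟨fun h => ?_, conjHom_mem_localSubgroup c⟩
  rw [← conjHom_inv_conjHom c g]
  exact conjHom_mem_localSubgroup _ h

theorem exists_closed_subwalk {a b : V} (P : G.Walk a b) (hP : ¬ P.IsPath) :
    ∃ (y : V) (A : G.Walk a y) (B : G.Walk y y) (E : G.Walk y b),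
      0 < B.length ∧ P = A.append (B.append E) := by
  classical
  induction P with
  | nil => exact absurd Walk.IsPath.nil hP
  | @cons a c b h P ih =>
    by_cases hp : P.IsPath
    · have ha : a ∈ P.support := by
        by_contra ha
        exact hP (hp.cons ha)
      exact ⟨a, Walk.nil, Walk.cons h (P.takeUntil a ha), P.dropUntil a ha, by simp,
        by simp⟩
    · obtain ⟨y, A, B, E, hB, rfl⟩ := ih hp
      exact ⟨y, Walk.cons h A, B, E, hB, rfl⟩

theorem eq_toWalk_of_isPath {a b : V} (h : G.Adj a b) {P : G.Walk b a} (hP : P.IsPath)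
    (he : s(a, b) ∈ P.edges) : P = h.symm.toWalk := by
  cases P with
  | nil => simp at he
  | @cons _ c _ k P =>
    rw [Walk.cons_isPath_iff] at hP
    rw [Walk.edges_cons, List.mem_cons] at he
    rcases he with he | he
    · have : a = c := by
        rw [Sym2.eq_swap] at he
        exact Sym2.congr_right.1 he
      subst this
      rw [(Walk.isPath_iff_nil.1 hP.1).eq_nil]
    · exact absurd (P.snd_mem_support_of_mem_edges he) hP.2

/-- Every closed walk of length at most `ρ` lies in the `ρ`-local subgroup. By induction on the
length: a closed walk that is neither a cycle nor trivial up to homotopy contains a shorter closed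
subwalk `B`, and splits into a conjugate of `B` and the shorter closed walk left by removing `B`. -/
theorem mk_mem_localSubgroup {ρ : ℕ} (n : ℕ) : ∀ {a : V} (P : G.Walk a a), P.length ≤ n → n ≤ ρ →
    (HomotopyClass.mk P : FundGroup G a) ∈ localSubgroup G ρ a := by
  induction n with
  | zero =>
    intro a P h _
    cases P with
    | nil => exact Subgroup.one_mem _
    | cons h P => simp at h
  | succ n ih =>
    intro a P hl hn
    cases P with
    | nil => exact Subgroup.one_mem _
    | @cons _ b _ h P =>
      rw [Walk.length_cons] at hl
      by_cases hP : P.IsPath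
      · by_cases he : s(a, b) ∈ P.edges
        · rw [eq_toWalk_of_isPath h hP he]
          have : HomotopyClass.mk (Walk.cons h h.symm.toWalk) = (1 : FundGroup G a) :=
            HomotopyClass.comp_inv (HomotopyClass.mk h.toWalk)
          rw [this]
          exact Subgroup.one_mem _
        · refine Subgroup.subset_closure ⟨a, Walk.nil, Walk.cons h P,
            (Walk.cons_isCycle_iff P h).2 ⟨hP, he⟩, ?_, ?_⟩
          · rw [Walk.length_cons]; omega
          · simp
      · obtain ⟨y, A, B, E, hB, rfl⟩ := exists_closed_subwalk P hP
        simp only [Walk.length_append] at hl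
        have hB' := conjHom_mem_localSubgroup (HomotopyClass.mk (Walk.cons h A))
          (ih B (by omega) (by omega))
        have hE := ih (Walk.cons h (A.append E))
          (by rw [Walk.length_cons, Walk.length_append]; omega) (by omega)
        -- With `R = cons h A`, the walk `R B E` is homotopic to `(R B R⁻) (R E)`.
        convert Subgroup.mul_mem _ hB' hE using 1
        change _ = HomotopyClass.comp (HomotopyClass.comp (HomotopyClass.mk (Walk.cons h A))
          (HomotopyClass.comp (HomotopyClass.mk B) (HomotopyClass.inv (HomotopyClass.mk
            (Walk.cons h A))))) (HomotopyClass.comp (HomotopyClass.mk (Walk.cons h A))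
              (HomotopyClass.mk E))
        simp only [HomotopyClass.comp_assoc]
        rw [← HomotopyClass.comp_assoc (HomotopyClass.inv _), HomotopyClass.inv_comp,
          HomotopyClass.nil_comp]
        rfl

/-- For a local covering the base vertex does not matter: at every vertex the local subgroup is the
stabilizer of every lift of that vertex. -/
theorem IsLocalCovering.mem_localSubgroup_iff {r : ℕ} (hp : IsLocalCovering r p) {a : V}
    (y : VertexLift p a) (g : FundGroup G a) :
    g ∈ localSubgroup G r a ↔ monodromy hp.isCovering g y = y := by
  obtain ⟨x, -, hx⟩ := hp.induces_iso
  obtain ⟨c, hc⟩ := exists_monodromy_eq hp.isCovering hp.connected ⟨x, rfl⟩ y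
  rw [← conjHom_mem_localSubgroup_iff c, ← hx, mem_range_inducedMap_iff hp.isCovering]
  change monodromy hp.isCovering (HomotopyClass.comp c (HomotopyClass.comp g
    (HomotopyClass.inv c))) _ = _ ↔ _
  rw [monodromy_comp, monodromy_comp, monodromy_inv_eq_iff, hc, eq_comm]

/-! ### Displacement -/

theorem lt_displacement_iff (ρ : ℕ) :
    (ρ : ℕ∞) < displacement p ↔ ∀ x y : W, p x = p y → C.edist x y ≤ ρ → x = y := by
  constructor
  · intro h x y hxy hd
    by_contra hne
    exact absurd (h.trans_le (sInf_le ⟨x, y, hne, hxy, rfl⟩)) (not_lt.2 hd)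
  · intro h
    rw [← Order.add_one_le_iff_of_not_isMax (by simp)]
    refine le_sInf ?_
    rintro _ ⟨x, y, hne, hxy, rfl⟩
    rw [Order.add_one_le_iff_of_not_isMax (by simp)]
    exact lt_of_not_ge fun hd => hne (h x y hxy hd)

/-- A generator `P Q P⁻` fixes a lift of `a` as soon as the closed walk `Q` lifts to closed
walks, and a short walk between two lifts projects to a closed walk in the `ρ`-local subgroup. -/
theorem lt_displacement_iff_localSubgroup_le {r : ℕ} (hp : IsLocalCovering r p) (ρ : ℕ) (a : V) :
    (ρ : ℕ∞) < displacement p ↔ localSubgroup G ρ a ≤ localSubgroup G r a := by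
  rw [lt_displacement_iff]
  obtain ⟨z, hz⟩ := hp.isCovering.surjective_vertices a
  constructor
  · intro h
    refine (Subgroup.closure_le _).2 ?_
    rintro _ ⟨b, P, Q, -, hl, rfl⟩
    rw [SetLike.mem_coe, hp.mem_localSubgroup_iff ⟨z, hz⟩]
    change walkLift hp.isCovering ((P.append Q).append P.reverse) ⟨z, hz⟩ = _
    rw [walkLift_append, walkLift_append]
    generalize hy : walkLift hp.isCovering P ⟨z, hz⟩ = y
    have hQ : walkLift hp.isCovering Q y = y :=
      (Subtype.ext (h y.1 _ (y.2.trans (walkLift hp.isCovering Q y).2.symm)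
        ((edist_walkLift_le hp.isCovering Q y).trans (by exact_mod_cast hl)))).symm
    rw [hQ]
    exact (monodromy_inv_eq_iff hp.isCovering (HomotopyClass.mk P) _ _).2 hy
  · intro h x y hxy hd
    have hne : C.edist x y ≠ ⊤ := ne_top_of_le_ne_top (by simp) hd
    obtain ⟨Q, hQ⟩ := exists_walk_of_edist_ne_top hne
    rw [← hQ] at hd
    obtain ⟨c, -⟩ := exists_monodromy_eq hp.isCovering hp.connected
      (⟨z, hz⟩ : VertexLift p a) (⟨x, rfl⟩ : VertexLift p (p x))
    have h1 : (HomotopyClass.mk ((Q.map p).copy rfl hxy.symm) : FundGroup G (p x)) ∈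
        localSubgroup G ρ (p x) :=
      mk_mem_localSubgroup ρ _ (by simpa using hd) le_rfl
    have h2 := (conjHom_mem_localSubgroup_iff c _).1 (h (conjHom_mem_localSubgroup c h1))
    rw [hp.mem_localSubgroup_iff ⟨x, rfl⟩] at h2
    have h3 : ∀ (b : V) (e : p y = b), (walkLift hp.isCovering ((Q.map p).copy rfl e)
        (⟨x, rfl⟩ : VertexLift p (p x))).1 = y := by
      rintro _ rfl
      rw [Walk.copy_rfl_rfl, walkLift_map]
    exact (congrArg Subtype.val h2).symm.trans (h3 _ hxy.symm)

/-! ### Isomorphism of coverings -/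

/-- The lifting criterion: if every class fixing the lift `y` of `a` also fixes the lift `z`, then
there is a homomorphism of coverings that maps `y` to `z`, and hence commutes with monodromy. -/
theorem exists_coveringHom (hp : IsCovering p) (hq : IsCovering q) (hC : C.Connected) {a : V}
    (y : VertexLift p a) (z : VertexLift q a)
    (h : ∀ g : FundGroup G a, monodromy hp g y = y → monodromy hq g z = z) :
    ∃ φ : C →g D, ∀ (b : V) (c : HomotopyClass G a b),
      φ (monodromy hp c y).1 = (monodromy hq c z).1 := by
  -- Send `x` to the end of the lift at `z` of any class `c x` whose lift at `y` ends in `x`; by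
  -- `key`, the choice of `c x` does not matter.
  choose c hc using fun x : W => exists_monodromy_eq hp hC y (⟨x, rfl⟩ : VertexLift p (p x))
  have key : ∀ (b : V) (g : HomotopyClass G a b),
      (monodromy hq (c (monodromy hp g y).1) z).1 = (monodromy hq g z).1 := by
    intro b g
    have h1 := hc (monodromy hp g y).1
    generalize c (monodromy hp g y).1 = c' at h1
    generalize hx : monodromy hp g y = x at c' h1
    obtain ⟨x, rfl⟩ := x
    exact congrArg Subtype.val ((monodromy_comp_inv_eq_iff hq c' g z).1
      (h _ ((monodromy_comp_inv_eq_iff hp c' g y).2 (h1.trans hx.symm))))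
  refine ⟨⟨fun x => (monodromy hq (c x) z).1, fun {x x'} hxx => ?_⟩, key⟩
  let e := HomotopyClass.mk (p.map_adj hxx).toWalk
  have h1 : monodromy hp (HomotopyClass.comp (c x) e) y = ⟨x', rfl⟩ := by
    rw [monodromy_comp, hc]
    exact moveLift_eq hp (p.map_adj hxx) hxx
  have h2 := key _ (HomotopyClass.comp (c x) e)
  rw [h1] at h2
  rw [h2, monodromy_comp]
  exact adj_moveLift hq (p.map_adj hxx) _

theorem coveringIso_of_monodromy (hp : IsCovering p) (hq : IsCovering q) (hC : C.Connected)
    (hD : D.Connected) {a : V} (y : VertexLift p a) (z : VertexLift q a)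
    (h : ∀ g : FundGroup G a, monodromy hp g y = y ↔ monodromy hq g z = z) :
    CoveringIso p q := by
  obtain ⟨φ, hφ⟩ := exists_coveringHom hp hq hC y z fun g => (h g).1
  obtain ⟨ψ, hψ⟩ := exists_coveringHom hq hp hD z y fun g => (h g).2
  have h1 : ∀ x, ψ (φ x) = x := fun x => by
    obtain ⟨c, hc⟩ := exists_monodromy_eq hp hC y ⟨x, rfl⟩
    have k := hψ _ c
    rwa [← hφ, hc] at k
  have h2 : ∀ x, φ (ψ x) = x := fun x => by
    obtain ⟨c, hc⟩ := exists_monodromy_eq hq hD z ⟨x, rfl⟩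
    have k := hφ _ c
    rwa [← hψ, hc] at k
  refine ⟨⟨⟨φ, ψ, h1, h2⟩, fun {x x'} => ⟨fun k => ?_, fun k => φ.map_adj k⟩⟩, fun x => ?_⟩
  · have := ψ.map_adj k
    simpa [h1] using this
  · obtain ⟨c, hc⟩ := exists_monodromy_eq hp hC y ⟨x, rfl⟩
    change q (φ x) = p x
    have := hφ _ c
    rw [hc] at this
    rw [this]
    exact (monodromy hq c z).2

theorem CoveringIso.exists_monodromy_iff (hp : IsCovering p) (hq : IsCovering q)
    (h : CoveringIso p q) {a : V} (y : VertexLift p a) :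
    ∃ z : VertexLift q a, ∀ g : FundGroup G a, monodromy hp g y = y ↔ monodromy hq g z = z := by
  obtain ⟨φ, hφ⟩ := h
  let F : ∀ {b : V}, VertexLift p b → VertexLift q b := fun x => ⟨φ x.1, (hφ x.1).trans x.2⟩
  have comm : ∀ {a b : V} (P : G.Walk a b) (x : VertexLift p a),
      walkLift hq P (F x) = F (walkLift hp P x) := by
    intro a b P
    induction P with
    | nil => exact fun _ => rfl
    | cons h P ih =>
      intro x
      rw [walkLift, walkLift, ← ih,
        moveLift_eq hq h (y := F (moveLift hp h x)) (φ.map_adj_iff.2 (adj_moveLift hp h x))]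
  refine ⟨F y, fun g => ?_⟩
  induction g using Quot.ind with
  | mk P =>
    change walkLift hp P y = y ↔ walkLift hq P (F y) = F y
    rw [comm]
    refine ⟨congrArg F, fun h => Subtype.ext (φ.injective (congrArg Subtype.val h))⟩

theorem coveringIso_iff_localSubgroup_eq {r ρ : ℕ} (hp : IsLocalCovering r p)
    (hq : IsLocalCovering ρ q) (a : V) :
    CoveringIso p q ↔ localSubgroup G r a = localSubgroup G ρ a := by
  obtain ⟨y, hy⟩ := hp.isCovering.surjective_vertices a
  obtain ⟨z, hz⟩ := hq.isCovering.surjective_vertices a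
  constructor
  · intro h
    obtain ⟨z, hz⟩ := h.exists_monodromy_iff hp.isCovering hq.isCovering ⟨y, hy⟩
    ext g
    rw [hp.mem_localSubgroup_iff ⟨y, hy⟩, hq.mem_localSubgroup_iff z, hz]
  · intro h
    refine coveringIso_of_monodromy hp.isCovering hq.isCovering hp.connected hq.connected
      ⟨y, hy⟩ ⟨z, hz⟩ fun g => ?_
    rw [← hp.mem_localSubgroup_iff, ← hq.mem_localSubgroup_iff, h]

/-! ### Balls -/

theorem mem_verts_halfBall_iff {v x : V} {ρ : ℕ} :
    x ∈ (halfBall G v ρ).verts ↔ ∃ R : G.Walk v x, 2 * R.length ≤ ρ := by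
  classical
  constructor
  · rintro ⟨P, hP, hx⟩
    have hs := congrArg Walk.length (P.take_spec hx)
    rw [Walk.length_append] at hs
    rcases le_total (P.takeUntil x hx).length (P.dropUntil x hx).length with h | h
    · exact ⟨P.takeUntil x hx, by omega⟩
    · exact ⟨(P.dropUntil x hx).reverse, by rw [Walk.length_reverse]; omega⟩
  · rintro ⟨R, hR⟩
    exact ⟨R.append R.reverse, by rw [Walk.length_append, Walk.length_reverse]; omega,
      by simp⟩

theorem edist_le_of_mem_halfBall {v x y : V} {ρ : ℕ} (hx : x ∈ (halfBall G v ρ).verts)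
    (hy : y ∈ (halfBall G v ρ).verts) : G.edist x y ≤ ρ := by
  obtain ⟨R, hR⟩ := mem_verts_halfBall_iff.1 hx
  obtain ⟨S, hS⟩ := mem_verts_halfBall_iff.1 hy
  refine (R.reverse.append S).edist_le.trans ?_
  rw [Walk.length_append, Walk.length_reverse]
  exact_mod_cast (by omega : R.length + S.length ≤ ρ)

theorem halfBall_adj_map (p : C →g G) {v x y : W} {ρ : ℕ} (h : (halfBall C v ρ).Adj x y) :
    (halfBall G (p v) ρ).Adj (p x) (p y) := by
  obtain ⟨P, hP, he⟩ := h
  refine ⟨P.map p, by simpa using hP, ?_⟩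
  rw [Walk.edges_map]
  exact List.mem_map.2 ⟨_, he, rfl⟩

theorem mem_halfBall_map (p : C →g G) {v x : W} {ρ : ℕ} (h : x ∈ (halfBall C v ρ).verts) :
    p x ∈ (halfBall G (p v) ρ).verts := by
  obtain ⟨P, hP, hx⟩ := h
  refine ⟨P.map p, by simpa using hP, ?_⟩
  rw [Walk.support_map]
  exact List.mem_map.2 ⟨_, hx, rfl⟩

theorem exists_closed_lift (hp : IsCovering p) {ρ : ℕ}
    (h : ∀ x y : W, p x = p y → C.edist x y ≤ ρ → x = y) (v : W) (P : G.Walk (p v) (p v))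
    (hP : P.length ≤ ρ) : ∃ Q : C.Walk v v, Q.map p = P := by
  obtain ⟨Q, hQ⟩ := exists_walk_to_walkLift hp P ⟨v, rfl⟩
  have hd := edist_walkLift_le hp P ⟨v, rfl⟩
  generalize walkLift hp P ⟨v, rfl⟩ = y at hd Q hQ
  obtain ⟨y, hy⟩ := y
  obtain rfl : v = y := h v y hy.symm (hd.trans (by exact_mod_cast hP))
  exact ⟨Q, hQ⟩

theorem preservesHalfBalls_of_lt_displacement (hp : IsCovering p) {ρ : ℕ}
    (h : (ρ : ℕ∞) < displacement p) : PreservesHalfBalls p ρ := by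
  rw [lt_displacement_iff] at h
  intro v
  have inj : ∀ {x y : W}, x ∈ (halfBall C v ρ).verts → y ∈ (halfBall C v ρ).verts →
      p x = p y → x = y := fun hx hy e => h _ _ e (edist_le_of_mem_halfBall hx hy)
  let f : (halfBall C v ρ).verts → (halfBall G (p v) ρ).verts :=
    fun x => ⟨p x.1, mem_halfBall_map p x.2⟩
  have hf : Function.Bijective f := by
    refine ⟨fun x y e => Subtype.ext (inj x.2 y.2 (congrArg Subtype.val e)), ?_⟩
    rintro ⟨b, P, hP, hb⟩
    obtain ⟨Q, rfl⟩ := exists_closed_lift hp h v P hP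
    rw [Walk.support_map] at hb
    obtain ⟨x, hx, rfl⟩ := List.mem_map.1 hb
    exact ⟨⟨x, Q, by simpa using hP, hx⟩, rfl⟩
  refine ⟨⟨Equiv.ofBijective f hf, fun {x y} => ⟨?_, halfBall_adj_map p⟩⟩, fun _ => rfl⟩
  rintro ⟨P, hP, he⟩
  obtain ⟨Q, rfl⟩ := exists_closed_lift hp h v P hP
  rw [Walk.length_map] at hP
  rw [Walk.edges_map] at he
  obtain ⟨e, he, hxy⟩ := List.mem_map.1 he
  induction e using Sym2.ind with
  | _ x' y' =>
    have hx' : x' ∈ (halfBall C v ρ).verts := ⟨Q, hP, Q.fst_mem_support_of_mem_edges he⟩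
    have hy' : y' ∈ (halfBall C v ρ).verts := ⟨Q, hP, Q.snd_mem_support_of_mem_edges he⟩
    rcases Sym2.eq_iff.1 hxy with ⟨h1, h2⟩ | ⟨h1, h2⟩
    · rw [inj hx' x.2 h1, inj hy' y.2 h2] at he
      exact ⟨Q, hP, he⟩
    · rw [inj hx' y.2 h1, inj hy' x.2 h2] at he
      exact Subgraph.adj_symm _ (show (halfBall C v ρ).Adj y x from ⟨Q, hP, he⟩)

/-- Given a walk of length at most `ρ` between two lifts `x`, `y` of a vertex, look at the ball
around its middle vertex `m`. If the length is even, the ball contains both lifts. If it is odd, the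
ball contains `x` and the last-but-one vertex `z`; the projection of the edge `yz` then lies in the
projected ball and joins the images of `x` and `z`, so that `xz` is an edge as well as `yz`. -/
theorem PreservesHalfBalls.lt_displacement (hp : IsCovering p) {ρ : ℕ}
    (h : PreservesHalfBalls p ρ) : (ρ : ℕ∞) < displacement p := by
  rw [lt_displacement_iff]
  intro x y hxy hd
  have hne : C.edist x y ≠ ⊤ := ne_top_of_le_ne_top (by simp) hd
  obtain ⟨Q, hQ⟩ := exists_walk_of_edist_ne_top hne
  rw [← hQ] at hd
  replace hd : Q.length ≤ ρ := by exact_mod_cast hd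
  clear hQ hne
  obtain ⟨m, A, B, hAB, hl⟩ : ∃ (m : W) (A : C.Walk x m) (B : C.Walk y m),
      A.length + B.length ≤ ρ ∧ (B.length = A.length ∨ B.length = A.length + 1) := by
    refine ⟨_, Q.take (Q.length / 2), (Q.drop (Q.length / 2)).reverse, ?_⟩
    rw [Walk.length_reverse, Walk.take_length, Walk.drop_length]
    omega
  have hx : x ∈ (halfBall C m ρ).verts :=
    mem_verts_halfBall_iff.2 ⟨A.reverse, by rw [Walk.length_reverse]; omega⟩
  obtain ⟨φ, hφ⟩ := h m
  rcases hl with hl | hl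
  · have hy : y ∈ (halfBall C m ρ).verts :=
      mem_verts_halfBall_iff.2 ⟨B.reverse, by rw [Walk.length_reverse]; omega⟩
    have : φ ⟨x, hx⟩ = φ ⟨y, hy⟩ := Subtype.ext (by rw [hφ, hφ]; exact hxy)
    exact congrArg Subtype.val (φ.injective this)
  · cases B with
    | nil => simp at hl
    | @cons _ z _ k B =>
      rw [Walk.length_cons] at hl hAB
      have hz : z ∈ (halfBall C m ρ).verts :=
        mem_verts_halfBall_iff.2 ⟨B.reverse, by rw [Walk.length_reverse]; omega⟩
      have hk : G.Adj (p x) (p z) := hxy ▸ p.map_adj k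
      have hadj : (halfBall G (p m) ρ).Adj (p x) (p z) := by
        refine ⟨(A.map p).reverse.append (Walk.cons hk (B.map p)), ?_, by simp⟩
        simp only [Walk.length_append, Walk.length_reverse, Walk.length_cons, Walk.length_map]
        omega
      have hxz : (halfBall C m ρ).coe.Adj ⟨x, hx⟩ ⟨z, hz⟩ := by
        rw [← φ.map_adj_iff, Subgraph.coe_adj, hφ, hφ]
        exact hadj
      exact hp.adj_lift_unique (Subgraph.coe_adj_sub _ _ _ hxz).symm k.symm hxy

end LocalCovering

/-- `p n : C n → G` is any choice of an `n`-local covering of `G` for every `n`. -/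
theorem mainTheorem10 {V : Type*} (G : SimpleGraph V) (hG : G.Connected)
    {W : ℕ → Type*} (C : ∀ n, SimpleGraph (W n)) (p : ∀ n, C n →g G)
    (hp : ∀ n, LocalCovering.IsLocalCovering n (p n)) (r : ℕ) (x₀ : V) :
    (∀ ρ : ℕ, r ≤ ρ → List.TFAE
      [(ρ : ℕ∞) < LocalCovering.displacement (p r),
       LocalCovering.PreservesHalfBalls (p r) ρ,
       LocalCovering.localSubgroup G ρ x₀ ≤ LocalCovering.localSubgroup G r x₀,
       LocalCovering.CoveringIso (p r) (p ρ)]) ∧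
    ((LocalCovering.displacement (p r) = ⊤ ∧
        ∀ ρ : ℕ, r ≤ ρ →
          (ρ : ℕ∞) < LocalCovering.displacement (p r) ∧
          LocalCovering.PreservesHalfBalls (p r) ρ ∧
          LocalCovering.localSubgroup G ρ x₀ ≤ LocalCovering.localSubgroup G r x₀ ∧
          LocalCovering.CoveringIso (p r) (p ρ)) ∨
      ∃ d : ℕ, LocalCovering.displacement (p r) = (d : ℕ∞) + 1 ∧
        IsGreatest {ρ : ℕ | r ≤ ρ ∧
          (ρ : ℕ∞) < LocalCovering.displacement (p r) ∧
          LocalCovering.PreservesHalfBalls (p r) ρ ∧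
          LocalCovering.localSubgroup G ρ x₀ ≤ LocalCovering.localSubgroup G r x₀ ∧
          LocalCovering.CoveringIso (p r) (p ρ)} d) := by
  have tfae : ∀ ρ : ℕ, r ≤ ρ → List.TFAE
      [(ρ : ℕ∞) < LocalCovering.displacement (p r),
       LocalCovering.PreservesHalfBalls (p r) ρ,
       LocalCovering.localSubgroup G ρ x₀ ≤ LocalCovering.localSubgroup G r x₀,
       LocalCovering.CoveringIso (p r) (p ρ)] := by
    intro ρ hρ
    tfae_have 1 → 2 :=
      LocalCovering.preservesHalfBalls_of_lt_displacement (hp r).isCovering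
    tfae_have 2 → 1 := LocalCovering.PreservesHalfBalls.lt_displacement (hp r).isCovering
    tfae_have 1 ↔ 3 := LocalCovering.lt_displacement_iff_localSubgroup_le (hp r) ρ x₀
    tfae_have 3 ↔ 4 := by
      rw [LocalCovering.coveringIso_iff_localSubgroup_eq (hp r) (hp ρ) x₀]
      exact ⟨fun h => le_antisymm (LocalCovering.localSubgroup_mono hρ x₀) h, fun h => h.ge⟩
    tfae_finish
  have all : ∀ ρ : ℕ, r ≤ ρ → (ρ : ℕ∞) < LocalCovering.displacement (p r) →
      (ρ : ℕ∞) < LocalCovering.displacement (p r) ∧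
      LocalCovering.PreservesHalfBalls (p r) ρ ∧
      LocalCovering.localSubgroup G ρ x₀ ≤ LocalCovering.localSubgroup G r x₀ ∧
      LocalCovering.CoveringIso (p r) (p ρ) := fun ρ hρ h =>
    ⟨h, ((tfae ρ hρ).out 0 1).1 h, ((tfae ρ hρ).out 0 2).1 h, ((tfae ρ hρ).out 0 3).1 h⟩
  refine ⟨tfae, ?_⟩
  have hr : (r : ℕ∞) < LocalCovering.displacement (p r) :=
    (LocalCovering.lt_displacement_iff_localSubgroup_le (hp r) r x₀).2 le_rfl
  cases hd : LocalCovering.displacement (p r) with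
  | top => exact Or.inl ⟨rfl, fun ρ hρ => hd ▸ all ρ hρ (hd ▸ ENat.natCast_lt_top ρ)⟩
  | coe n =>
    rw [hd, Nat.cast_lt] at hr
    obtain ⟨d, rfl⟩ : ∃ d, n = d + 1 := ⟨n - 1, by omega⟩
    refine Or.inr ⟨d, by push_cast; rfl, ⟨Nat.le_of_lt_succ hr, ?_⟩, ?_⟩
    · rw [← hd]
      exact all d (Nat.le_of_lt_succ hr) (hd ▸ Nat.cast_lt.2 d.lt_succ_self)
    · rintro ρ ⟨-, h, -⟩
      exact Nat.le_of_lt_succ (Nat.cast_lt.1 h)
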